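/- \textbf{Terminology.} An inverse monoid is regarded as an algebra in the signature $(\cdot,1,{}^{-1})$; its natural partial order is $a\le b \iff a=aa^{-1}b$, and $\sigma$ is its least group congruence ($a\mathrel\sigma b$ iff $a,b$ have a common lower bound), so $S/\sigma$ is the greatest group image of $S$. An $F$-inverse monoid is an inverse monoid in which every $\sigma$-class has a greatest element; it is regarded as an algebra in the signature $(\cdot,1,{}^{-1},{}^{\mathfrak m})$, where $s^{\mathfrak m}$ is the greatest element of the $\sigma$-class of $s$. These algebras form a variety. Let $X$ be a set and let $\mathbb I\mathfrak m_X$ be the set of formal expressions $u_0v_1^{\mathfrak m}u_1\cdots v_n^{\mathfrak m}u_n$ with $n\ge 0$ and $u_i,v_i\in(X\cup X^{-1})^*$. For a map of $X$ into an $F$-inverse monoid $S$, $w_S$ denotes the value of $w\in\mathbb I\mathfrak m_X$ in $S$; in a group, $^{\mathfrak m}$ is the identity operation. For a relation $R$ on $\mathbb I\mathfrak m_X$, $\operatorname{FInv}\langle X\mid R\rangle$ is the quotient of the free $F$-inverse monoid on $X$ by the congruence generated by the pairs $(u,v)\in R$. Let $G$ be an $X$-generated group and $\Gamma_X$ its Cayley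 graph: the vertex set is $G$, and for all $g\in G$ and $a\in X\cup X^{-1}$ there is an edge labeled $a$ from $g$ to $ga_G$, whose inverse is the edge labeled $a^{-1}$ from $ga_G$ to $g$. Let $\operatorname{Sub}\Gamma_X$ be the lattice of all (not necessarily connected, possibly empty) subgraphs, that is, sets of vertices and edges closed under endpoints and inverses of edges. A term $w=u_0v_1^{\mathfrak m}u_1\cdots v_n^{\mathfrak m}u_n$ \emph{labels a journey from $g$ to $h$ in} $\Delta\in\operatorname{Sub}\Gamma_X$ if, starting at $g$ and alternately following the paths labeled $u_0,u_1,\dots,u_n$ and jumping from the current vertex $k$ to $k(v_i)_G$, one ends at $h$, and all these paths (including empty paths, which are single vertices) lie in $\Delta$. Given a relation $R$ on $\mathbb I\mathfrak m_X$ such that $u_G=v_G$ for all $(u,v)\in R$, a subgraph $\Delta$ is called closed if for all $(u,v)\in R$ and all vertices $g,h$ of $\Delta$, $u$ labels a journey from $g$ to $h$ in $\Delta$ if and only if $v$ does. There is a unique closure operator $c_R$ on $(\operatorname{Sub}\Gamma_X,\subseteq)$ with these closed elements. For an $X$-generated $F$-inverse monoid $S$ with $G=S/\sigma$, $c_S$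 is the closure operator obtained in this way from the relation $\{(u,v)\in \mathbb I\mathfrak m_X\times\mathbb I\mathfrak m_X : u_S=v_S\}$. \textbf{Proposition.} Let $X$ be a set, let $R$ be a relation on $\mathbb I\mathfrak m_X$, let $S=\operatorname{FInv}\langle X\mid R\rangle$, and let $G=S/\sigma$ be its greatest group image, with Cayley graph $\Gamma_X$. Then $c_R=c_S$ as closure operators on $(\operatorname{Sub}\Gamma_X,\subseteq)$. -/

import Mathlib

universe u v

/-! ## Inverse monoids, natural partial order, greatest group image -/

/-- Inverse monoids, as a variety in the signature `(·, 1, ⁻¹)`. -/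
class InverseMonoid (S : Type u) extends Monoid S, Inv S where
  mul_inv_mul_self : ∀ a : S, a * a⁻¹ * a = a
  inv_inv' : ∀ a : S, a⁻¹⁻¹ = a
  mul_inv_rev' : ∀ a b : S, (a * b)⁻¹ = b⁻¹ * a⁻¹
  idem_comm : ∀ a b : S, (a * a⁻¹) * (b * b⁻¹) = (b * b⁻¹) * (a * a⁻¹)

/-- The natural partial order of an inverse monoid: `a ≤ b` iff `a = a a⁻¹ b`. -/
def NatLE {S : Type u} [InverseMonoid S] (a b : S) : Prop := a = a * a⁻¹ * b

/-- `a σ b` iff `a` and `b` have a common lower bound in the natural partial order. -/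
def SigmaRel {S : Type u} [InverseMonoid S] (a b : S) : Prop := ∃ c, NatLE c a ∧ NatLE c b

namespace InverseMonoid

variable {S : Type u} [InverseMonoid S]

theorem proj_mul_proj (x y : S) :
    (x * x⁻¹ * y) * (x * x⁻¹ * y)⁻¹ = (x * x⁻¹) * (y * y⁻¹) := by
  have h := idem_comm x y
  have h2 : (x * x⁻¹) * (x * x⁻¹) = x * x⁻¹ := by
    rw [← mul_assoc, mul_inv_mul_self]
  rw [mul_inv_rev', mul_inv_rev', inv_inv']
  calc x * x⁻¹ * y * (y⁻¹ * (x * x⁻¹)) = x * x⁻¹ * ((y * y⁻¹) * (x * x⁻¹)) := by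
        simp only [mul_assoc]
    _ = (x * x⁻¹) * (x * x⁻¹) * (y * y⁻¹) := by rw [← h]; simp only [mul_assoc]
    _ = _ := by rw [h2]

theorem mul_proj (a y : S) : a * (y * y⁻¹) = (a * y) * (a * y)⁻¹ * a := by
  have h := idem_comm a⁻¹ y
  rw [inv_inv'] at h
  calc a * (y * y⁻¹) = a * a⁻¹ * a * (y * y⁻¹) := by rw [mul_inv_mul_self]
    _ = a * ((a⁻¹ * a) * (y * y⁻¹)) := by simp only [mul_assoc]
    _ = a * ((y * y⁻¹) * (a⁻¹ * a)) := by rw [h]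
    _ = _ := by rw [mul_inv_rev']; simp only [mul_assoc]

theorem natLE_of_eq {a b : S} (x : S) (h : a = x * x⁻¹ * b) : NatLE a b := by
  have h2 : a * a⁻¹ = (x * x⁻¹) * (b * b⁻¹) := by rw [h, proj_mul_proj]
  have h3 : b * b⁻¹ * b = b := mul_inv_mul_self b
  unfold NatLE
  rw [h2, mul_assoc, h3, ← h]

theorem natLE_antisymm {a b : S} (h : NatLE a b) (h' : NatLE b a) : a = b := by
  unfold NatLE at h h'
  calc a = a * a⁻¹ * b := h
    _ = a * a⁻¹ * (b * b⁻¹ * a) := by rw [← h']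
    _ = (a * a⁻¹) * (b * b⁻¹) * a := by simp only [mul_assoc]
    _ = (b * b⁻¹) * (a * a⁻¹) * a := by rw [idem_comm]
    _ = b * b⁻¹ * (a * a⁻¹ * a) := by simp only [mul_assoc]
    _ = b := by rw [mul_inv_mul_self, ← h']

theorem natLE_trans {a b c : S} (h : NatLE a b) (h' : NatLE b c) : NatLE a c := by
  refine natLE_of_eq (a * a⁻¹ * b) ?_
  rw [proj_mul_proj, mul_assoc (a * a⁻¹), ← h']
  exact h

theorem natLE_refl (a : S) : NatLE a a := (mul_inv_mul_self a).symm

theorem natLE_mul {a b c d : S} (h : NatLE a b) (h' : NatLE c d) : NatLE (a * c) (b * d) := by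
  refine natLE_of_eq (a * a⁻¹ * (b * c)) ?_
  rw [proj_mul_proj]
  calc a * c = (a * a⁻¹ * b) * (c * c⁻¹ * d) := by rw [← h, ← h']
    _ = a * a⁻¹ * (b * (c * c⁻¹)) * d := by simp only [mul_assoc]
    _ = _ := by rw [mul_proj]; simp only [mul_assoc]

theorem natLE_inv {a b : S} (h : NatLE a b) : NatLE a⁻¹ b⁻¹ := by
  refine natLE_of_eq (b⁻¹ * a) ?_
  rw [← mul_proj]
  conv_lhs => rw [h]
  simp only [mul_inv_rev', inv_inv']

theorem sigmaRel_of_natLE {a b : S} (h : NatLE a b) : SigmaRel a b := ⟨a, natLE_refl a, h⟩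

theorem sigmaRel_symm {a b : S} (h : SigmaRel a b) : SigmaRel b a :=
  let ⟨c, h1, h2⟩ := h; ⟨c, h2, h1⟩

theorem sigmaRel_trans {a b c : S} (h : SigmaRel a b) (h' : SigmaRel b c) : SigmaRel a c := by
  obtain ⟨x, hxa, hxb⟩ := h
  obtain ⟨y, hyb, hyc⟩ := h'
  refine ⟨(x * x⁻¹) * y, ?_, natLE_trans (natLE_of_eq x rfl) hyc⟩
  have : x * x⁻¹ * y = y * y⁻¹ * x := by
    calc x * x⁻¹ * y = x * x⁻¹ * (y * y⁻¹ * b) := by rw [← hyb]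
      _ = (x * x⁻¹) * (y * y⁻¹) * b := by simp only [mul_assoc]
      _ = (y * y⁻¹) * (x * x⁻¹ * b) := by rw [idem_comm]; simp only [mul_assoc]
      _ = _ := by rw [← hxb]
  rw [this]
  exact natLE_trans (natLE_of_eq y rfl) hxa

end InverseMonoid

/-- The least group congruence `σ` of an inverse monoid. -/
def sigmaCon (S : Type u) [InverseMonoid S] : Con S where
  r := SigmaRel
  iseqv := ⟨fun a => InverseMonoid.sigmaRel_of_natLE (InverseMonoid.natLE_refl a),
    InverseMonoid.sigmaRel_symm, InverseMonoid.sigmaRel_trans⟩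
  mul' := fun ⟨x, h1, h2⟩ ⟨y, h3, h4⟩ =>
    ⟨x * y, InverseMonoid.natLE_mul h1 h3, InverseMonoid.natLE_mul h2 h4⟩

/-- The greatest group image `S/σ`. -/
abbrev MaxGroupImage (S : Type u) [InverseMonoid S] : Type u := (sigmaCon S).Quotient

/-- The natural projection `S → S/σ`. -/
def sigmaProj (S : Type u) [InverseMonoid S] : S →* MaxGroupImage S := (sigmaCon S).mk'

instance MaxGroupImage.instGroup (S : Type u) [InverseMonoid S] : Group (MaxGroupImage S) where
  inv := Quotient.map (fun a : S => a⁻¹)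
    (fun _ _ ⟨x, h1, h2⟩ => ⟨x⁻¹, InverseMonoid.natLE_inv h1, InverseMonoid.natLE_inv h2⟩)
  inv_mul_cancel := by
    rintro ⟨a⟩
    refine (Con.eq (sigmaCon S)).2 (InverseMonoid.sigmaRel_of_natLE ?_)
    refine InverseMonoid.natLE_of_eq a⁻¹ ?_
    rw [InverseMonoid.inv_inv', mul_one]

/-! ## F-inverse monoids -/

/-- F-inverse monoids in the signature `(·, 1, ⁻¹, ᵐ)`: `mx a` is the greatest element of the
`σ`-class of `a` in the natural partial order. -/
class FInverseMonoid (S : Type u) extends InverseMonoid S where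
  mx : S → S
  mx_sigma : ∀ a : S, SigmaRel a (mx a)
  le_mx : ∀ a b : S, SigmaRel a b → NatLE b (mx a)

namespace FInverseMonoid

/-- An inverse monoid with a unary operation satisfying the two identities `a = a a⁻¹ aᵐ` and
`(y y⁻¹ a)ᵐ = aᵐ` is F-inverse. -/
abbrev ofIdentities {S : Type u} [InverseMonoid S] (m : S → S)
    (h1 : ∀ a, a = a * a⁻¹ * m a) (h2 : ∀ y a, m (y * y⁻¹ * a) = m a) : FInverseMonoid S where
  mx := m
  mx_sigma a := InverseMonoid.sigmaRel_of_natLE (h1 a)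
  le_mx a b := by
    rintro ⟨c, hca, hcb⟩
    have ha : m c = m a := by rw [hca, h2]
    have hb : m c = m b := by rw [hcb, h2]
    rw [← ha, hb]
    exact h1 b

variable {S : Type u} [FInverseMonoid S]

theorem le_mx_self (a : S) : a = a * a⁻¹ * mx a :=
  le_mx a a (InverseMonoid.sigmaRel_of_natLE (InverseMonoid.natLE_refl a))

theorem mx_proj_mul (y a : S) : mx (y * y⁻¹ * a) = mx a := by
  have h : SigmaRel (y * y⁻¹ * a) a :=
    InverseMonoid.sigmaRel_of_natLE (InverseMonoid.natLE_of_eq y rfl)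
  apply InverseMonoid.natLE_antisymm
  · exact le_mx _ _ (InverseMonoid.sigmaRel_trans (InverseMonoid.sigmaRel_symm h) (mx_sigma _))
  · exact le_mx _ _ (InverseMonoid.sigmaRel_trans h (mx_sigma _))

end FInverseMonoid

/-! ## Quotients of F-inverse monoids by generated congruences -/

/-- The congruence (in the signature `(·, 1, ⁻¹, ᵐ)`) generated by a relation `r`. -/
inductive FCongGen {S : Type u} [FInverseMonoid S] (r : S → S → Prop) : S → S → Prop
  | of {a b : S} : r a b → FCongGen r a b
  | refl (a : S) : FCongGen r a a
  | symm {a b : S} : FCongGen r a b → FCongGen r b a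
  | trans {a b c : S} : FCongGen r a b → FCongGen r b c → FCongGen r a c
  | mul {a b c d : S} : FCongGen r a b → FCongGen r c d → FCongGen r (a * c) (b * d)
  | inv {a b : S} : FCongGen r a b → FCongGen r a⁻¹ b⁻¹
  | mx {a b : S} : FCongGen r a b → FCongGen r (FInverseMonoid.mx a) (FInverseMonoid.mx b)

def fCongSetoid {S : Type u} [FInverseMonoid S] (r : S → S → Prop) : Setoid S :=
  ⟨FCongGen r, FCongGen.refl, FCongGen.symm, FCongGen.trans⟩

/-- The quotient of an F-inverse monoid by the congruence generated by `r`. -/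
def FQuot {S : Type u} [FInverseMonoid S] (r : S → S → Prop) : Type u := Quotient (fCongSetoid r)

namespace FQuot

variable {S : Type u} [FInverseMonoid S] {r : S → S → Prop}

def mk (r : S → S → Prop) (a : S) : FQuot r := Quotient.mk (fCongSetoid r) a

instance instInverseMonoid : InverseMonoid (FQuot r) where
  mul := Quotient.map₂ (· * ·) (fun _ _ h _ _ h' => FCongGen.mul h h')
  one := mk r 1
  inv := Quotient.map (·⁻¹) (fun _ _ h => FCongGen.inv h)
  mul_assoc := by rintro ⟨a⟩ ⟨b⟩ ⟨c⟩; exact congrArg (mk r) (mul_assoc a b c)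
  one_mul := by rintro ⟨a⟩; exact congrArg (mk r) (one_mul a)
  mul_one := by rintro ⟨a⟩; exact congrArg (mk r) (mul_one a)
  mul_inv_mul_self := by rintro ⟨a⟩; exact congrArg (mk r) (InverseMonoid.mul_inv_mul_self a)
  inv_inv' := by rintro ⟨a⟩; exact congrArg (mk r) (InverseMonoid.inv_inv' a)
  mul_inv_rev' := by rintro ⟨a⟩ ⟨b⟩; exact congrArg (mk r) (InverseMonoid.mul_inv_rev' a b)
  idem_comm := by rintro ⟨a⟩ ⟨b⟩; exact congrArg (mk r) (InverseMonoid.idem_comm a b)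

instance instFInverseMonoid : FInverseMonoid (FQuot r) :=
  FInverseMonoid.ofIdentities
    (Quotient.map FInverseMonoid.mx (fun _ _ h => FCongGen.mx h))
    (by rintro ⟨a⟩; exact congrArg (mk r) (FInverseMonoid.le_mx_self a))
    (by rintro ⟨y⟩ ⟨a⟩; exact congrArg (mk r) (FInverseMonoid.mx_proj_mul y a))

end FQuot

/-! ## The free F-inverse monoid -/

/-- All terms over `X` in the signature `(·, 1, ⁻¹, ᵐ)`. -/
inductive FTerm (X : Type u) : Type u
  | var : X → FTerm X
  | one : FTerm X
  | mul : FTerm X → FTerm X → FTerm X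
  | inv : FTerm X → FTerm X
  | mx : FTerm X → FTerm X

/-- Equality of terms in the variety of F-inverse monoids, generated by the defining identities. -/
inductive FTerm.Eqv {X : Type u} : FTerm X → FTerm X → Prop
  | refl (a) : Eqv a a
  | symm {a b} : Eqv a b → Eqv b a
  | trans {a b c} : Eqv a b → Eqv b c → Eqv a c
  | mul_congr {a b c d} : Eqv a b → Eqv c d → Eqv (mul a c) (mul b d)
  | inv_congr {a b} : Eqv a b → Eqv (inv a) (inv b)
  | mx_congr {a b} : Eqv a b → Eqv (mx a) (mx b)
  | mul_assoc (a b c) : Eqv (mul (mul a b) c) (mul a (mul b c))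
  | one_mul (a) : Eqv (mul one a) a
  | mul_one (a) : Eqv (mul a one) a
  | mul_inv_mul_self (a) : Eqv (mul (mul a (inv a)) a) a
  | inv_inv (a) : Eqv (inv (inv a)) a
  | mul_inv_rev (a b) : Eqv (inv (mul a b)) (mul (inv b) (inv a))
  | idem_comm (a b) : Eqv (mul (mul a (inv a)) (mul b (inv b))) (mul (mul b (inv b)) (mul a (inv a)))
  | le_mx (a) : Eqv a (mul (mul a (inv a)) (mx a))
  | mx_proj_mul (y a) : Eqv (mx (mul (mul y (inv y)) a)) (mx a)

def FTerm.setoid (X : Type u) : Setoid (FTerm X) :=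
  ⟨FTerm.Eqv, FTerm.Eqv.refl, FTerm.Eqv.symm, FTerm.Eqv.trans⟩

/-- The free F-inverse monoid on `X`. -/
def FreeFInverse (X : Type u) : Type u := Quotient (FTerm.setoid X)

namespace FreeFInverse

variable {X : Type u}

def of (x : X) : FreeFInverse X := Quotient.mk (FTerm.setoid X) (FTerm.var x)

instance instInverseMonoid : InverseMonoid (FreeFInverse X) where
  mul := Quotient.map₂ FTerm.mul (fun _ _ h _ _ h' => FTerm.Eqv.mul_congr h h')
  one := Quotient.mk (FTerm.setoid X) FTerm.one
  inv := Quotient.map FTerm.inv (fun _ _ h => FTerm.Eqv.inv_congr h)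
  mul_assoc := by rintro ⟨a⟩ ⟨b⟩ ⟨c⟩; exact Quotient.sound (FTerm.Eqv.mul_assoc a b c)
  one_mul := by rintro ⟨a⟩; exact Quotient.sound (FTerm.Eqv.one_mul a)
  mul_one := by rintro ⟨a⟩; exact Quotient.sound (FTerm.Eqv.mul_one a)
  mul_inv_mul_self := by rintro ⟨a⟩; exact Quotient.sound (FTerm.Eqv.mul_inv_mul_self a)
  inv_inv' := by rintro ⟨a⟩; exact Quotient.sound (FTerm.Eqv.inv_inv a)
  mul_inv_rev' := by rintro ⟨a⟩ ⟨b⟩; exact Quotient.sound (FTerm.Eqv.mul_inv_rev a b)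
  idem_comm := by rintro ⟨a⟩ ⟨b⟩; exact Quotient.sound (FTerm.Eqv.idem_comm a b)

instance instFInverseMonoid : FInverseMonoid (FreeFInverse X) :=
  FInverseMonoid.ofIdentities
    (Quotient.map FTerm.mx (fun _ _ h => FTerm.Eqv.mx_congr h))
    (by rintro ⟨a⟩; exact Quotient.sound (FTerm.Eqv.le_mx a))
    (by rintro ⟨y⟩ ⟨a⟩; exact Quotient.sound (FTerm.Eqv.mx_proj_mul y a))

end FreeFInverse

/-! ## Words, terms of the form `u₀ v₁ᵐ u₁ ⋯ vₙᵐ uₙ`, and presentations -/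

/-- `(X ∪ X⁻¹)*`; the letter `(x, true)` is `x` and `(x, false)` is the formal inverse `x⁻¹`. -/
abbrev InvWord (X : Type u) : Type u := List (X × Bool)

/-- The value of a letter of `X ∪ X⁻¹` under an assignment `ι` of the generators. -/
def letterVal {X : Type u} {M : Type v} [Inv M] (ι : X → M) (a : X × Bool) : M :=
  if a.2 then ι a.1 else (ι a.1)⁻¹

/-- The value of a word of `(X ∪ X⁻¹)*`. -/
def InvWord.val {X : Type u} {M : Type v} [Monoid M] [Inv M] (ι : X → M) (w : InvWord X) : M :=
  (w.map (letterVal ι)).prod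

/-- The symbols occurring in a formal expression `u₀ v₁ᵐ u₁ ⋯ vₙᵐ uₙ`: single letters of
`X ∪ X⁻¹`, and blocks `vᵐ` with `v` a word of `(X ∪ X⁻¹)*`. -/
inductive ImSymbol (X : Type u) : Type u
  | letter : X × Bool → ImSymbol X
  | jump : InvWord X → ImSymbol X

/-- The set of formal expressions `u₀ v₁ᵐ u₁ ⋯ vₙᵐ uₙ` with `uᵢ, vᵢ ∈ (X ∪ X⁻¹)*` and `n ≥ 0`,
each written as the sequence of its symbols. -/
abbrev ImTerm (X : Type u) : Type u := List (ImSymbol X)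

/-- The value `w_S` of a term in an F-inverse monoid `S`. -/
def ImTerm.val {X : Type u} {S : Type v} [FInverseMonoid S] (ι : X → S) : ImTerm X → S
  | [] => 1
  | .letter a :: w => letterVal ι a * ImTerm.val ι w
  | .jump v :: w => FInverseMonoid.mx (InvWord.val ι v) * ImTerm.val ι w

/-- The value `w_G` of a term in a group `G`, where `ᵐ` is the identity operation. -/
def ImTerm.groupVal {X : Type u} {G : Type v} [Group G] (ι : X → G) : ImTerm X → G
  | [] => 1
  | .letter a :: w => letterVal ι a * ImTerm.groupVal ι w
  | .jump v :: w => InvWord.val ι v * ImTerm.groupVal ι w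

/-- `FInv⟨X | R⟩`: the quotient of the free F-inverse monoid on `X` by the congruence generated by
the pairs of values of `R`-related terms. -/
abbrev PresentedFInverse {X : Type u} (R : ImTerm X → ImTerm X → Prop) : Type u :=
  FQuot (S := FreeFInverse X) fun a b =>
    ∃ s t : ImTerm X, R s t ∧ a = s.val FreeFInverse.of ∧ b = t.val FreeFInverse.of

/-- The canonical map `X → FInv⟨X | R⟩`. -/
def PresentedFInverse.of {X : Type u} (R : ImTerm X → ImTerm X → Prop) (x : X) :
    PresentedFInverse R :=
  FQuot.mk _ (FreeFInverse.of x)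

/-! ## Subgraphs of the Cayley graph of a group -/

/-- Edges of the Cayley graph: `(g, a)` is the edge labeled `a ∈ X ∪ X⁻¹` leaving the vertex `g`. -/
abbrev CayleyEdge (X : Type u) (G : Type v) : Type (max u v) := G × (X × Bool)

namespace CayleyEdge

variable {X : Type u} {G : Type v} [Group G]

def src (e : CayleyEdge X G) : G := e.1

def tgt (ι : X → G) (e : CayleyEdge X G) : G := e.1 * letterVal ι e.2

def rev (ι : X → G) (e : CayleyEdge X G) : CayleyEdge X G := (e.tgt ι, (e.2.1, !e.2.2))

end CayleyEdge

/-- Subgraphs of the Cayley graph of `G` with respect to `ι : X → G`: sets of vertices and edges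
closed under initial vertex, terminal vertex and inverse edge (possibly empty, not necessarily
connected). -/
@[ext]
structure CayleySubgraph {X : Type u} {G : Type v} [Group G] (ι : X → G) where
  verts : Set G
  edges : Set (CayleyEdge X G)
  src_mem : ∀ e ∈ edges, e.src ∈ verts
  tgt_mem : ∀ e ∈ edges, e.tgt ι ∈ verts
  rev_mem : ∀ e ∈ edges, e.rev ι ∈ edges

namespace CayleySubgraph

variable {X : Type u} {G : Type v} [Group G] {ι : X → G}

instance instPartialOrder : PartialOrder (CayleySubgraph ι) where
  le A B := A.verts ⊆ B.verts ∧ A.edges ⊆ B.edges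
  le_refl _ := ⟨subset_rfl, subset_rfl⟩
  le_trans _ _ _ h h' := ⟨h.1.trans h'.1, h.2.trans h'.2⟩
  le_antisymm _ _ h h' := CayleySubgraph.ext (h.1.antisymm h'.1) (h.2.antisymm h'.2)

instance instInfSet : InfSet (CayleySubgraph ι) where
  sInf Y :=
    { verts := {g | ∀ A ∈ Y, g ∈ A.verts}
      edges := {e | ∀ A ∈ Y, e ∈ A.edges}
      src_mem := fun e he A hA => A.src_mem e (he A hA)
      tgt_mem := fun e he A hA => A.tgt_mem e (he A hA)
      rev_mem := fun e he A hA => A.rev_mem e (he A hA) }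

instance instCompleteLattice : CompleteLattice (CayleySubgraph ι) :=
  completeLatticeOfInf _ fun _ =>
    ⟨fun A hA => And.intro (fun _ (h : ∀ A ∈ _, _) => h A hA) (fun _ (h : ∀ A ∈ _, _) => h A hA),
      fun _ hB => And.intro (fun _ hg _ hA => (hB hA).1 hg) (fun _ he _ hA => (hB hA).2 he)⟩

/-- `Δ.IsJourney w g h`: the term `w` labels a journey from `g` to `h` in `Δ`. A letter of `w` is
read by traversing an edge of `Δ`; a block `vᵐ` is read by jumping from the current vertex `k` of
`Δ` to the vertex `k v_G`, which must also belong to `Δ`. -/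
def IsJourney (Δ : CayleySubgraph ι) : ImTerm X → G → G → Prop
  | [], g, h => g ∈ Δ.verts ∧ g = h
  | .letter a :: w, g, h => (g, a) ∈ Δ.edges ∧ IsJourney Δ w (g * letterVal ι a) h
  | .jump v :: w, g, h => g ∈ Δ.verts ∧ IsJourney Δ w (g * InvWord.val ι v) h

/-- `Δ` is closed for `R`: for `(s, t) ∈ R` and vertices `g, h` of `Δ`, the term `s` labels a
journey from `g` to `h` in `Δ` iff `t` does. -/
def IsRelClosed (R : ImTerm X → ImTerm X → Prop) (Δ : CayleySubgraph ι) : Prop :=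
  ∀ s t, R s t → ∀ g ∈ Δ.verts, ∀ h ∈ Δ.verts, (Δ.IsJourney s g h ↔ Δ.IsJourney t g h)

theorem IsJourney.eq {Δ : CayleySubgraph ι} {w : ImTerm X} {g h : G} (hj : Δ.IsJourney w g h) :
    h = g * w.groupVal ι := by
  induction w generalizing g with
  | nil => simpa [ImTerm.groupVal] using hj.2.symm
  | cons a w ih => cases a <;> simpa [ImTerm.groupVal, mul_assoc] using ih hj.2

theorem isJourney_sInf {Y : Set (CayleySubgraph ι)} (w : ImTerm X) (g h : G)
    (hh : h = g * w.groupVal ι) :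
    (sInf Y).IsJourney w g h ↔ ∀ A ∈ Y, A.IsJourney w g h := by
  induction w generalizing g with
  | nil =>
    have : g = h := by simpa [ImTerm.groupVal] using hh.symm
    exact ⟨fun h A hA => ⟨h.1 A hA, this⟩, fun h => ⟨fun A hA => (h A hA).1, this⟩⟩
  | cons a w ih =>
    cases a with
    | letter a =>
      have ih := ih (g * letterVal ι a) (by rw [hh, ImTerm.groupVal, mul_assoc])
      exact ⟨fun h A hA => ⟨h.1 A hA, ih.1 h.2 A hA⟩,
        fun h => ⟨fun A hA => (h A hA).1, ih.2 fun A hA => (h A hA).2⟩⟩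
    | jump v =>
      have ih := ih (g * InvWord.val ι v) (by rw [hh, ImTerm.groupVal, mul_assoc])
      exact ⟨fun h A hA => ⟨h.1 A hA, ih.1 h.2 A hA⟩,
        fun h => ⟨fun A hA => (h A hA).1, ih.2 fun A hA => (h A hA).2⟩⟩

theorem isRelClosed_sInf {R : ImTerm X → ImTerm X → Prop}
    (hR : ∀ s t, R s t → s.groupVal ι = t.groupVal ι) (Y : Set (CayleySubgraph ι))
    (hY : ∀ A ∈ Y, IsRelClosed R A) : IsRelClosed R (sInf Y) := by
  intro s t hst g hg h hh
  have e := hR s t hst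
  constructor
  · intro hj
    have hs := hj.eq
    rw [isJourney_sInf _ _ _ hs] at hj
    rw [isJourney_sInf _ _ _ (e ▸ hs)]
    exact fun A hA => (hY A hA s t hst g (hg A hA) h (hh A hA)).1 (hj A hA)
  · intro hj
    have ht := hj.eq
    rw [isJourney_sInf _ _ _ ht] at hj
    rw [isJourney_sInf _ _ _ (e.symm ▸ ht)]
    exact fun A hA => (hY A hA s t hst g (hg A hA) h (hh A hA)).2 (hj A hA)

end CayleySubgraph

/-! ## The closure operators -/

/-- The closure operator on the lattice of subgraphs of the Cayley graph of `G` whose closed elements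
are the subgraphs closed for `R`, where `R`-related terms are equal in `G`. -/
def relClosure {X : Type u} {G : Type v} [Group G] (ι : X → G) (R : ImTerm X → ImTerm X → Prop)
    (hR : ∀ s t, R s t → s.groupVal ι = t.groupVal ι) : ClosureOperator (CayleySubgraph ι) :=
  ClosureOperator.ofCompletePred (CayleySubgraph.IsRelClosed R)
    (CayleySubgraph.isRelClosed_sInf hR)

/-- The canonical map `X → S/σ`. -/
def groupGen {X : Type u} {S : Type v} [InverseMonoid S] (ι : X → S) : X → MaxGroupImage S :=
  fun x => sigmaProj S (ι x)

theorem letterVal_groupGen {X : Type u} {S : Type v} [InverseMonoid S] (ι : X → S)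
    (a : X × Bool) : letterVal (groupGen ι) a = sigmaProj S (letterVal ι a) := by
  unfold letterVal
  split <;> rfl

theorem InvWord.val_groupGen {X : Type u} {S : Type v} [InverseMonoid S] (ι : X → S)
    (w : InvWord X) : w.val (groupGen ι) = sigmaProj S (w.val ι) := by
  simp only [InvWord.val, map_list_prod, List.map_map]
  congr 1
  exact List.map_congr_left fun a _ => letterVal_groupGen ι a

theorem ImTerm.groupVal_groupGen {X : Type u} {S : Type v} [FInverseMonoid S] (ι : X → S)
    (w : ImTerm X) : w.groupVal (groupGen ι) = sigmaProj S (w.val ι) := by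
  induction w with
  | nil => exact (map_one (sigmaProj S)).symm
  | cons a w ih =>
    cases a with
    | letter a => rw [ImTerm.groupVal, ImTerm.val, map_mul, ih, letterVal_groupGen]
    | jump v =>
      rw [ImTerm.groupVal, ImTerm.val, map_mul, ih, InvWord.val_groupGen]
      congr 1
      exact (Con.eq (sigmaCon S)).2 (FInverseMonoid.mx_sigma _)

/-- The closure operator `c_S` of an F-inverse monoid `S` with generators `ι : X → S`, on the subgraphs
of the Cayley graph of `S/σ`: it comes from the relation `s_S = t_S` on terms. -/
def monoidClosure {X : Type u} {S : Type v} [FInverseMonoid S] (ι : X → S) :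
    ClosureOperator (CayleySubgraph (groupGen ι)) :=
  relClosure (groupGen ι) (fun s t => s.val ι = t.val ι) fun s t h => by
    rw [ImTerm.groupVal_groupGen, ImTerm.groupVal_groupGen, h]

theorem PresentedFInverse.val_of {X : Type u} (R : ImTerm X → ImTerm X → Prop) (w : ImTerm X) :
    w.val (PresentedFInverse.of R) = FQuot.mk _ (w.val FreeFInverse.of) := by
  have hl : ∀ a : X × Bool, letterVal (PresentedFInverse.of R) a =
      FQuot.mk _ (letterVal FreeFInverse.of a) := by
    intro a
    unfold letterVal
    split <;> rfl
  have hw : ∀ v : InvWord X, v.val (PresentedFInverse.of R) =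
      FQuot.mk _ (v.val FreeFInverse.of) := by
    intro v
    induction v with
    | nil => rfl
    | cons a v ih =>
      have ih' : (List.map (letterVal (PresentedFInverse.of R)) v).prod = _ := ih
      rw [InvWord.val, List.map_cons, List.prod_cons, ih', hl]
      rfl
  induction w with
  | nil => rfl
  | cons a w ih =>
    cases a with
    | letter a => rw [ImTerm.val, ih, hl]; rfl
    | jump v => rw [ImTerm.val, ih, hw]; rfl

theorem PresentedFInverse.val_eq {X : Type u} {R : ImTerm X → ImTerm X → Prop} {s t : ImTerm X}
    (h : R s t) : s.val (PresentedFInverse.of R) = t.val (PresentedFInverse.of R) := by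
  rw [PresentedFInverse.val_of, PresentedFInverse.val_of]
  exact Quotient.sound (FCongGen.of ⟨s, t, h, rfl, rfl⟩)

/-- The closure operator `c_R` of a presentation `FInv⟨X | R⟩`, on the subgraphs of the Cayley graph
of the greatest group image of the presented F-inverse monoid. -/
def presentationClosure {X : Type u} (R : ImTerm X → ImTerm X → Prop) :
    ClosureOperator (CayleySubgraph (groupGen (PresentedFInverse.of R))) :=
  relClosure (groupGen (PresentedFInverse.of R)) R fun s t h => by
    rw [ImTerm.groupVal_groupGen, ImTerm.groupVal_groupGen, PresentedFInverse.val_eq h]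

/-! A subgraph `Δ` with vertex set `V` is turned into a model of the signature. Partial translations
`g ↦ g * γ` of `V` form an F-inverse monoid in which the operation `mx` enlarges the domain as far
as `V` allows. Sending each generator to translation along its edges in `Δ` gives every term `w` a
value: its shift is `w_G`, and its domain is the set of starting points of journeys labeled `w`
(`mem_dom_termVal`).

Hence, for relations valid in `G`, being closed means exactly that the relations hold in this monoid
under this assignment (`isRelClosed_iff`). If those of `R` hold, the universal property of the
presentation (`PresentedFInverse.val_eq_of_val_eq`) makes every equality of terms valid in `S` hold
as well. So `R` and equality in `S` have the same closed subgraphs, and these determine the closure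
operator. -/

/-! ## The F-inverse monoid of partial translations of a subset of a group -/

/-- Partial right translations of a set `V` of elements of a group: restrictions of
`g ↦ g * shift` to sets `dom ⊆ V` whose image lies in `V`. -/
@[ext]
structure PartialTranslation {G : Type v} [Group G] (V : Set G) where
  dom : Set G
  -- The shift is data because an empty domain does not determine it. Were all empty maps
  -- identified, they would form a zero and `σ` would be universal.
  shift : G
  dom_subset : ∀ g ∈ dom, g ∈ V
  image_subset : ∀ g ∈ dom, g * shift ∈ V

namespace PartialTranslation

variable {G : Type v} [Group G] {V : Set G}

theorem ext_mem {a b : PartialTranslation V} (hs : a.shift = b.shift)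
    (hd : ∀ g, g ∈ a.dom ↔ g ∈ b.dom) : a = b :=
  PartialTranslation.ext (Set.ext hd) hs

instance : Mul (PartialTranslation V) where
  mul a b :=
    { dom := {g | g ∈ a.dom ∧ g * a.shift ∈ b.dom}
      shift := a.shift * b.shift
      dom_subset := fun g hg => a.dom_subset g hg.1
      image_subset := fun g hg => by
        rw [← mul_assoc]
        exact b.image_subset _ hg.2 }

instance : One (PartialTranslation V) where
  one := ⟨V, 1, fun _ hg => hg, fun g hg => by rwa [mul_one]⟩

instance : Inv (PartialTranslation V) where
  inv a :=
    { dom := {g | g * a.shift⁻¹ ∈ a.dom}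
      shift := a.shift⁻¹
      dom_subset := fun g hg => by simpa using a.image_subset _ hg
      image_subset := fun g hg => a.dom_subset _ hg }

@[simp] theorem shift_mul (a b : PartialTranslation V) : (a * b).shift = a.shift * b.shift := rfl

@[simp] theorem mem_dom_mul (a b : PartialTranslation V) (g : G) :
    g ∈ (a * b).dom ↔ g ∈ a.dom ∧ g * a.shift ∈ b.dom := Iff.rfl

@[simp] theorem shift_one : (1 : PartialTranslation V).shift = 1 := rfl

@[simp] theorem mem_dom_one (g : G) : g ∈ (1 : PartialTranslation V).dom ↔ g ∈ V := Iff.rfl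

@[simp] theorem shift_inv (a : PartialTranslation V) : a⁻¹.shift = a.shift⁻¹ := rfl

@[simp] theorem mem_dom_inv (a : PartialTranslation V) (g : G) :
    g ∈ a⁻¹.dom ↔ g * a.shift⁻¹ ∈ a.dom := Iff.rfl

/-- The two containments in `V` are what the unit laws need, since `1` is defined on `V` only. The
element `a * a⁻¹` is the identity on `a.dom`, so `idem_comm` is the symmetry of intersection. -/
instance : InverseMonoid (PartialTranslation V) where
  mul_assoc a b c := ext_mem (by simp [mul_assoc]) fun g => by simp [mul_assoc, and_assoc]
  one_mul a := ext_mem (by simp) fun g => by simpa using a.dom_subset g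
  mul_one a := ext_mem (by simp) fun g => by simpa using a.image_subset g
  mul_inv_mul_self a := ext_mem (by simp) fun g => by simp
  inv_inv' a := ext_mem (by simp) fun g => by simp
  mul_inv_rev' a b := ext_mem (by simp) fun g => by simp [mul_assoc, and_comm]
  idem_comm a b := ext_mem (by simp) fun g => by simp [and_comm]

/-- The largest partial translation of `V` by a given group element. -/
def maximal (V : Set G) (γ : G) : PartialTranslation V :=
  ⟨{g | g ∈ V ∧ g * γ ∈ V}, γ, fun _ hg => hg.1, fun _ hg => hg.2⟩

@[simp] theorem shift_maximal (γ : G) : (maximal V γ).shift = γ := rfl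

@[simp] theorem mem_dom_maximal (γ g : G) : g ∈ (maximal V γ).dom ↔ g ∈ V ∧ g * γ ∈ V := Iff.rfl

/-- Every `a` restricts `maximal V a.shift`, and multiplying by `y * y⁻¹`, whose shift is `1`,
leaves the shift alone. -/
instance : FInverseMonoid (PartialTranslation V) :=
  FInverseMonoid.ofIdentities (fun a => maximal V a.shift)
    (fun a => ext_mem (by simp) fun g => by
      simpa using fun h => And.intro (a.dom_subset g h) (a.image_subset g h))
    (fun y a => by simp)

theorem mx_eq (a : PartialTranslation V) : FInverseMonoid.mx a = maximal V a.shift := rfl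

end PartialTranslation

/-! ## The universal property of presented F-inverse monoids -/

/-- The value of a term of the full signature in an F-inverse monoid. -/
def FTerm.eval {X : Type u} {S : Type v} [FInverseMonoid S] (ι : X → S) : FTerm X → S
  | .var x => ι x
  | .one => 1
  | .mul a b => a.eval ι * b.eval ι
  | .inv a => (a.eval ι)⁻¹
  | .mx a => FInverseMonoid.mx (a.eval ι)

theorem FTerm.Eqv.eval_eq {X : Type u} {S : Type v} [FInverseMonoid S] (ι : X → S)
    {a b : FTerm X} (h : FTerm.Eqv a b) : a.eval ι = b.eval ι := by
  induction h with
  | refl => rfl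
  | symm _ ih => exact ih.symm
  | trans _ _ ih ih' => exact ih.trans ih'
  | mul_congr _ _ ih ih' => simp only [FTerm.eval, ih, ih']
  | inv_congr _ ih => simp only [FTerm.eval, ih]
  | mx_congr _ ih => simp only [FTerm.eval, ih]
  | mul_assoc => exact _root_.mul_assoc _ _ _
  | one_mul => exact _root_.one_mul _
  | mul_one => exact _root_.mul_one _
  | mul_inv_mul_self => exact InverseMonoid.mul_inv_mul_self _
  | inv_inv => exact InverseMonoid.inv_inv' _
  | mul_inv_rev => exact InverseMonoid.mul_inv_rev' _ _
  | idem_comm => exact InverseMonoid.idem_comm _ _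
  | le_mx => exact FInverseMonoid.le_mx_self _
  | mx_proj_mul => exact FInverseMonoid.mx_proj_mul _ _

namespace FreeFInverse

variable {X : Type u} {S : Type v} [FInverseMonoid S]

/-- The extension of a map `X → S` to the free F-inverse monoid. -/
def lift (ι : X → S) : FreeFInverse X → S :=
  Quotient.lift (FTerm.eval ι) fun _ _ h => FTerm.Eqv.eval_eq ι h

theorem lift_of (ι : X → S) (x : X) : lift ι (of x) = ι x := rfl

theorem lift_mul (ι : X → S) (a b : FreeFInverse X) : lift ι (a * b) = lift ι a * lift ι b := by
  induction a using Quotient.inductionOn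
  induction b using Quotient.inductionOn
  rfl

theorem lift_inv (ι : X → S) (a : FreeFInverse X) : lift ι a⁻¹ = (lift ι a)⁻¹ := by
  induction a using Quotient.inductionOn
  rfl

theorem lift_mx (ι : X → S) (a : FreeFInverse X) :
    lift ι (FInverseMonoid.mx a) = FInverseMonoid.mx (lift ι a) := by
  induction a using Quotient.inductionOn
  rfl

theorem lift_letterVal (ι : X → S) (a : X × Bool) :
    lift ι (letterVal of a) = letterVal ι a := by
  unfold letterVal
  split
  · exact lift_of ι a.1
  · rw [lift_inv, lift_of]

theorem lift_wordVal (ι : X → S) (w : InvWord X) : lift ι (w.val of) = w.val ι := by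
  induction w with
  | nil => rfl
  | cons a w ih =>
    simp only [InvWord.val, List.map_cons, List.prod_cons, lift_mul, lift_letterVal] at ih ⊢
    rw [ih]

theorem lift_termVal (ι : X → S) (w : ImTerm X) : lift ι (w.val of) = w.val ι := by
  induction w with
  | nil => rfl
  | cons a w ih =>
    cases a with
    | letter a => rw [ImTerm.val, ImTerm.val, lift_mul, lift_letterVal, ih]
    | jump v => rw [ImTerm.val, ImTerm.val, lift_mul, lift_mx, lift_wordVal, ih]

/-- The kernel of `lift ι` respects all operations, including `mx`, so it contains the congruence
generated by any relation inside it. -/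
theorem lift_eq_of_fCongGen (ι : X → S) {r : FreeFInverse X → FreeFInverse X → Prop}
    (hr : ∀ a b, r a b → lift ι a = lift ι b) {a b : FreeFInverse X} (h : FCongGen r a b) :
    lift ι a = lift ι b := by
  induction h with
  | of h => exact hr _ _ h
  | refl => rfl
  | symm _ ih => exact ih.symm
  | trans _ _ ih ih' => exact ih.trans ih'
  | mul _ _ ih ih' => rw [lift_mul, lift_mul, ih, ih']
  | inv _ ih => rw [lift_inv, lift_inv, ih]
  | mx _ ih => rw [lift_mx, lift_mx, ih]

end FreeFInverse

/-- An equality of terms in `FInv⟨X | R⟩` holds in every F-inverse monoid satisfying `R`. -/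
theorem PresentedFInverse.val_eq_of_val_eq {X : Type u} {S : Type v} [FInverseMonoid S]
    {R : ImTerm X → ImTerm X → Prop} (ι : X → S) (hι : ∀ s t, R s t → s.val ι = t.val ι)
    {s t : ImTerm X} (h : s.val (PresentedFInverse.of R) = t.val (PresentedFInverse.of R)) :
    s.val ι = t.val ι := by
  rw [PresentedFInverse.val_of, PresentedFInverse.val_of] at h
  rw [← FreeFInverse.lift_termVal ι s, ← FreeFInverse.lift_termVal ι t]
  refine FreeFInverse.lift_eq_of_fCongGen ι ?_ (Quotient.exact h)
  rintro _ _ ⟨s, t, hst, rfl, rfl⟩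
  rw [FreeFInverse.lift_termVal, FreeFInverse.lift_termVal, hι s t hst]

/-! ## Journeys as values in the monoid of partial translations -/

namespace CayleySubgraph

variable {X : Type u} {G : Type v} [Group G] {ι : X → G} (Δ : CayleySubgraph ι)

/-- The partial translation of the vertices of `Δ` along its edges labeled `x`. -/
def edgeTranslation (x : X) : PartialTranslation Δ.verts :=
  ⟨{g | (g, (x, true)) ∈ Δ.edges}, ι x, fun _ hg => Δ.src_mem _ hg, fun _ hg => Δ.tgt_mem _ hg⟩

theorem shift_letterVal (a : X × Bool) :
    (letterVal Δ.edgeTranslation a).shift = letterVal ι a := by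
  unfold letterVal
  split <;> rfl

theorem mem_dom_letterVal (a : X × Bool) (g : G) :
    g ∈ (letterVal Δ.edgeTranslation a).dom ↔ (g, a) ∈ Δ.edges := by
  obtain ⟨x, _ | _⟩ := a
  -- An inverse letter is defined at `g` when an `x`-edge of `Δ` ends at `g`; reversing that edge
  -- gives the `x⁻¹`-edge leaving `g`.
  · change (g * (ι x)⁻¹, (x, true)) ∈ Δ.edges ↔ _
    constructor <;> intro h <;>
      simpa [CayleyEdge.rev, CayleyEdge.tgt, letterVal] using Δ.rev_mem _ h
  · exact Iff.rfl

theorem shift_wordVal (w : InvWord X) :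
    (w.val Δ.edgeTranslation).shift = w.val ι := by
  induction w with
  | nil => rfl
  | cons a w ih =>
    simp only [InvWord.val, List.map_cons, List.prod_cons, PartialTranslation.shift_mul,
      shift_letterVal] at ih ⊢
    rw [ih]

theorem shift_termVal (w : ImTerm X) :
    (w.val Δ.edgeTranslation).shift = w.groupVal ι := by
  induction w with
  | nil => rfl
  | cons a w ih =>
    cases a with
    | letter a =>
      rw [ImTerm.val, ImTerm.groupVal, PartialTranslation.shift_mul, ih, shift_letterVal]
    | jump v =>
      rw [ImTerm.val, ImTerm.groupVal, PartialTranslation.shift_mul, ih, PartialTranslation.mx_eq,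
        PartialTranslation.shift_maximal, shift_wordVal]

theorem IsJourney.mem_verts {Δ : CayleySubgraph ι} {w : ImTerm X} {g h : G}
    (hj : Δ.IsJourney w g h) : g ∈ Δ.verts := by
  cases w with
  | nil => exact hj.1
  | cons a w =>
    cases a with
    | letter a => exact Δ.src_mem _ hj.1
    | jump v => exact hj.1

/-- Composing partial maps matches concatenating journeys: letters act along edges of `Δ`, and `mx`
yields all jumps between vertices of `Δ`, because its value depends only on the shift of the block
and not on whether the block can be read in `Δ`. -/
theorem mem_dom_termVal (w : ImTerm X) (g : G) :
    g ∈ (w.val Δ.edgeTranslation).dom ↔ Δ.IsJourney w g (g * w.groupVal ι) := by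
  induction w generalizing g with
  | nil => simp [ImTerm.val, ImTerm.groupVal, IsJourney]
  | cons a w ih =>
    cases a with
    | letter a =>
      rw [ImTerm.val, ImTerm.groupVal, PartialTranslation.mem_dom_mul, mem_dom_letterVal,
        shift_letterVal, ih, mul_assoc]
      rfl
    | jump v =>
      rw [ImTerm.val, ImTerm.groupVal, PartialTranslation.mem_dom_mul, PartialTranslation.mx_eq,
        PartialTranslation.mem_dom_maximal, PartialTranslation.shift_maximal, shift_wordVal, ih,
        mul_assoc]
      -- The maximal translation also requires the landing vertex to lie in `Δ`; for a journey this
      -- follows from the remainder starting there.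
      exact ⟨fun h => ⟨h.1.1, h.2⟩, fun h => ⟨⟨h.1, h.2.mem_verts⟩, h.2⟩⟩

theorem isJourney_iff (w : ImTerm X) (g h : G) :
    Δ.IsJourney w g h ↔
      g ∈ (w.val Δ.edgeTranslation).dom ∧ h = g * (w.val Δ.edgeTranslation).shift := by
  rw [mem_dom_termVal, shift_termVal]
  exact ⟨fun hj => ⟨hj.eq ▸ hj, hj.eq⟩, fun ⟨hj, hh⟩ => hh ▸ hj⟩

/-- For relations valid in the group, `Δ` is closed iff the relations hold in the monoid of partial
translations of its vertices. -/
theorem isRelClosed_iff {R : ImTerm X → ImTerm X → Prop}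
    (hR : ∀ s t, R s t → s.groupVal ι = t.groupVal ι) :
    IsRelClosed R Δ ↔ ∀ s t, R s t → s.val Δ.edgeTranslation = t.val Δ.edgeTranslation := by
  constructor
  · intro hΔ s t hst
    -- Equality of shifts has to come from `hR`: if neither term labels a journey in `Δ`, closedness
    -- says nothing about them.
    have hs : (s.val Δ.edgeTranslation).shift = (t.val Δ.edgeTranslation).shift := by
      rw [shift_termVal, shift_termVal, hR s t hst]
    refine PartialTranslation.ext_mem hs fun g => ⟨fun hg => ?_, fun hg => ?_⟩
    · exact ((isJourney_iff Δ t g _).1 ((hΔ s t hst g (PartialTranslation.dom_subset _ g hg) _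
        (PartialTranslation.image_subset _ g hg)).1 ((isJourney_iff Δ s g _).2 ⟨hg, rfl⟩))).1
    · exact ((isJourney_iff Δ s g _).1 ((hΔ s t hst g (PartialTranslation.dom_subset _ g hg) _
        (PartialTranslation.image_subset _ g hg)).2 ((isJourney_iff Δ t g _).2 ⟨hg, rfl⟩))).1
  · intro hΔ s t hst g _ h _
    rw [isJourney_iff, isJourney_iff, hΔ s t hst]

end CayleySubgraph

/-! ### Comparison of the closed subgraphs for `R` and for `S`. -/

/-- From left to right this is the universal property applied to the partial translations of `Δ`;
the converse holds because `R` is contained in equality of values in `S`. -/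
theorem isRelClosed_presentation_iff {X : Type u} (R : ImTerm X → ImTerm X → Prop)
    (Δ : CayleySubgraph (groupGen (PresentedFInverse.of R))) :
    Δ.IsRelClosed R ↔ Δ.IsRelClosed fun s t =>
      s.val (PresentedFInverse.of R) = t.val (PresentedFInverse.of R) := by
  constructor
  · intro hΔ
    rw [CayleySubgraph.isRelClosed_iff Δ fun s t h => by
      rw [ImTerm.groupVal_groupGen, ImTerm.groupVal_groupGen, PresentedFInverse.val_eq h]] at hΔ
    rw [CayleySubgraph.isRelClosed_iff Δ fun s t h => by
      rw [ImTerm.groupVal_groupGen, ImTerm.groupVal_groupGen, h]]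
    exact fun s t h => PresentedFInverse.val_eq_of_val_eq _ hΔ h
  · exact fun hΔ s t hst => hΔ s t (PresentedFInverse.val_eq hst)

theorem mainTheorem5 {X : Type u} (R : ImTerm X → ImTerm X → Prop) :
    presentationClosure R = monoidClosure (PresentedFInverse.of R) := by
  unfold presentationClosure monoidClosure relClosure
  -- Both operators are built by `ClosureOperator.ofCompletePred`, so only their predicates of
  -- closedness need comparing.
  congr 1
  funext Δ
  exact propext (isRelClosed_presentation_iff R Δ)
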